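/- Let $\mathsf W$ (parameters) and $\mathsf X$ (observations) be standard Borel spaces, let $\mathsf Y=\mathbb R$ and $n\ge 0$. Let $P_W$ be a probability measure on $\mathsf W$ (the prior), and let $P_{X|W}$ and $K_{Y|X,W}$ be probability kernels from $\mathsf W$ to $\mathsf X$ and from $\mathsf X\times\mathsf W$ to $\mathbb R$. Put $P_{Z|W}=P_{X|W}K_{Y|X,W}$ and let the parameter $W$, the data $Z^n=(Z_1,\dots,Z_n)$, $Z_i=(X_i,Y_i)$, and the fresh pair $Z=(X,Y)$ have joint law $$P_{W,Z^n,Z}=P_W\Big(\prod_{i=1}^n P_{Z_i|W}\Big)P_{Z|W},\qquad P_{Z_i|W}=P_{Z|W}.$$ For a random element $V$, let $R_2(Y|V)=\inf_{\psi}\mathbb E[(Y-\psi(V))^2]\in[0,\infty]$, the infimum being over measurable real-valued functions $\psi$, and define the minimum excess risk for the quadratic loss by $$\mathrm{MER}_2=R_2(Y|X,Z^n)-R_2(Y|X,W)$$ (nothing is claimed in the case $R_2(Y|X,Z^n)=R_2(Y|X,W)=\infty$, in which the difference is undefined). For Borel probability measures $P,Q$ on $\mathbb R$ let $\mathcal W_2$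 be the $2$-Wasserstein distance, $\mathcal W_2^2(P,Q)=\inf_\pi\mathbb E_{(U,V)\sim\pi}[|U-V|^2]$, the infimum being over all couplings $\pi$ of $P$ and $Q$. Theorem. If $\mathbb E[Y^2|x,w]=\int y^2\,K_{Y|x,w}(\mathrm dy)<\infty$ for all $(x,w)\in\mathsf X\times\mathsf W$, then $$\mathrm{MER}_2\le 4\sqrt{\mathbb E[Y^2]\;\mathbb E\big[\mathcal W_2^2(K_{Y|X,W'},K_{Y|X,W})\big]},$$ where $W'$ is a sample from the posterior distribution $P_{W|X,Z^n}$, conditionally independent of everything else given $(X,Z^n)$. Here expectations of nonnegative quantities take values in $[0,\infty]$ and $0\cdot\infty=0$. -/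

import Mathlib

open MeasureTheory ProbabilityTheory
open scoped ENNReal

noncomputable section

namespace BayesLearning

/-- The kernel `a ↦ κ(a)^{⊗ n}`: the law of `n` samples that are i.i.d. given `a`. -/
def iidKernel {α β : Type*} [MeasurableSpace α] [MeasurableSpace β]
    (κ : Kernel α β) [IsMarkovKernel κ] (n : ℕ) : Kernel α (Fin n → β) where
  toFun a := Measure.pi fun _ => κ a
  measurable' := by
    refine Measurable.measure_of_isPiSystem_of_isProbabilityMeasure
      generateFrom_pi.symm isPiSystem_pi ?_
    rintro _ ⟨s, hs, rfl⟩
    simp only [Measure.pi_pi]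
    exact Finset.measurable_prod _ fun i _ => κ.measurable_coe (hs i (Set.mem_univ i))

instance {α β : Type*} [MeasurableSpace α] [MeasurableSpace β]
    (κ : Kernel α β) [IsMarkovKernel κ] (n : ℕ) : IsMarkovKernel (iidKernel κ n) :=
  ⟨fun a => by
    change IsProbabilityMeasure (Measure.pi fun _ : Fin n => κ a)
    infer_instance⟩

/-- The Bayes risk `R_ℓ(Y|V) = inf_ψ E[ℓ(Y, ψ(V))]` for a nonnegative loss `ℓ`, the infimum being
over all measurable decision rules `ψ`. The expectation is an element of `[0, ∞]`. -/
def bayesRisk {Ω 𝓨 𝓐 𝓥 : Type*} [MeasurableSpace Ω] [MeasurableSpace 𝓐] [MeasurableSpace 𝓥]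
    (ℓ : 𝓨 → 𝓐 → ℝ≥0∞) (μ : Measure Ω) (Y : Ω → 𝓨) (V : Ω → 𝓥) : ℝ≥0∞ :=
  ⨅ (ψ : 𝓥 → 𝓐) (_ : Measurable ψ), ∫⁻ ω, ℓ (Y ω) (ψ (V ω)) ∂μ

/-- The sample space of `(W, Zⁿ, Z)`, where `Zⁿ` is the data set and `Z = (X, Y)` consists of the
fresh observation and the quantity to be predicted. -/
abbrev Sample (𝓦 𝓧 𝓨 : Type*) (n : ℕ) : Type _ := 𝓦 × (Fin n → 𝓧 × 𝓨) × (𝓧 × 𝓨)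

namespace Sample

variable {𝓦 𝓧 𝓨 : Type*} {n : ℕ}

/-- The model parameters `W`. -/
def W (s : Sample 𝓦 𝓧 𝓨 n) : 𝓦 := s.1

/-- The data set `Zⁿ`. -/
def data (s : Sample 𝓦 𝓧 𝓨 n) : Fin n → 𝓧 × 𝓨 := s.2.1

/-- The fresh observation `X`. -/
def X (s : Sample 𝓦 𝓧 𝓨 n) : 𝓧 := s.2.2.1

/-- The quantity `Y` to be predicted. -/
def Y (s : Sample 𝓦 𝓧 𝓨 n) : 𝓨 := s.2.2.2

end Sample

section Model

variable {𝓦 𝓧 𝓨 : Type*} [MeasurableSpace 𝓦] [MeasurableSpace 𝓧] [MeasurableSpace 𝓨]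

/-- The generative model `P_{Z|W} = P_{X|W} K_{Y|X,W}` of the predictive modeling framework. -/
def generativeKernel (PX : Kernel 𝓦 𝓧) (K : Kernel (𝓧 × 𝓦) 𝓨) : Kernel 𝓦 (𝓧 × 𝓨) :=
  Kernel.compProd PX K.swapLeft

instance (PX : Kernel 𝓦 𝓧) [IsMarkovKernel PX] (K : Kernel (𝓧 × 𝓦) 𝓨) [IsMarkovKernel K] :
    IsMarkovKernel (generativeKernel PX K) := by
  unfold generativeKernel; infer_instance

/-- The joint law `P_{W,Zⁿ,Z} = P_W (∏ᵢ P_{Zᵢ|W}) P_{Z|W}`, with `P_{Zᵢ|W} = P_{Z|W}`. -/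
def jointLaw (prior : Measure 𝓦) (PX : Kernel 𝓦 𝓧) [IsMarkovKernel PX]
    (K : Kernel (𝓧 × 𝓦) 𝓨) [IsMarkovKernel K] (n : ℕ) : Measure (Sample 𝓦 𝓧 𝓨 n) :=
  Measure.compProd prior
    (Kernel.prod (iidKernel (generativeKernel PX K) n) (generativeKernel PX K))

instance (prior : Measure 𝓦) [IsProbabilityMeasure prior] (PX : Kernel 𝓦 𝓧) [IsMarkovKernel PX]
    (K : Kernel (𝓧 × 𝓦) 𝓨) [IsMarkovKernel K] (n : ℕ) :
    IsProbabilityMeasure (jointLaw prior PX K n) := by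
  unfold jointLaw; infer_instance

/-- The minimum excess risk `MER_ℓ = R_ℓ(Y|X,Zⁿ) - R_ℓ(Y|X,W)`, as a signed difference of two
elements of `[0, ∞]`. -/
def MER {𝓐 : Type*} [MeasurableSpace 𝓐] (ℓ : 𝓨 → 𝓐 → ℝ≥0∞)
    (prior : Measure 𝓦) (PX : Kernel 𝓦 𝓧) [IsMarkovKernel PX]
    (K : Kernel (𝓧 × 𝓦) 𝓨) [IsMarkovKernel K] (n : ℕ) : EReal :=
  (bayesRisk ℓ (jointLaw prior PX K n) Sample.Y (fun s => (s.X, s.data)) : EReal)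
    - (bayesRisk ℓ (jointLaw prior PX K n) Sample.Y (fun s => (s.X, s.W)) : EReal)

/-- The posterior distribution `P_{W|X,Zⁿ}`. -/
def posteriorKernel [StandardBorelSpace 𝓦] [Nonempty 𝓦]
    (prior : Measure 𝓦) [IsProbabilityMeasure prior] (PX : Kernel 𝓦 𝓧) [IsMarkovKernel PX]
    (K : Kernel (𝓧 × 𝓦) 𝓨) [IsMarkovKernel K] (n : ℕ) : Kernel (𝓧 × (Fin n → 𝓧 × 𝓨)) 𝓦 :=
  condDistrib Sample.W (fun s => (s.X, s.data)) (jointLaw prior PX K n)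

/-- The joint law of `((W, Zⁿ, Z), W')`, where `W'` is sampled from the posterior distribution
`P_{W|X,Zⁿ}`, conditionally independent of everything else given `(X, Zⁿ)`. -/
def jointLawWithPosteriorSample [StandardBorelSpace 𝓦] [Nonempty 𝓦]
    (prior : Measure 𝓦) [IsProbabilityMeasure prior] (PX : Kernel 𝓦 𝓧) [IsMarkovKernel PX]
    (K : Kernel (𝓧 × 𝓦) 𝓨) [IsMarkovKernel K] (n : ℕ) : Measure (Sample 𝓦 𝓧 𝓨 n × 𝓦) :=
  Measure.compProd (jointLaw prior PX K n)
    ((posteriorKernel prior PX K n).comap (fun s => (s.X, s.data))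
      ((measurable_fst.comp (measurable_snd.comp measurable_snd)).prodMk
        (measurable_fst.comp measurable_snd)))

end Model

/-- The quadratic loss `ℓ(y, a) = (y - a)²`. -/
def quadraticLoss (y a : ℝ) : ℝ≥0∞ := ENNReal.ofReal ((y - a) ^ 2)

/-- The `2`-Wasserstein distance: `W₂²(P, Q) = inf_π E_{(U,V) ∼ π} |U - V|²`, the infimum being over
all couplings `π` of `P` and `Q`. -/
def wasserstein2 (P Q : Measure ℝ) : ℝ≥0∞ :=
  (⨅ (π : Measure (ℝ × ℝ)) (_ : π.fst = P ∧ π.snd = Q),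
    ∫⁻ p, ENNReal.ofReal (|p.1 - p.2| ^ 2) ∂π) ^ (1 / 2 : ℝ)

end BayesLearning

end

/-! The excess risk is bounded in two ways, by `E[Y²]` and by `E[W₂²]`; the minimum of two numbers
is at most their geometric mean, so the bound holds already with constant 1 in place of 4. The first
bound comes from predicting 0. For the second, let `m(x,w)` be the mean of `K (x, w)`. By the
bias-variance decomposition given `(X, W)`, any rule blind to `Y` has risk equal to the expected
conditional variance plus its mean squared distance to `m(X,W)`. For the posterior mean of `m`,
Jensen over `W'` bounds that distance by `E[(m(X,W') - m(X,W))²]`, and a difference of means is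
controlled by any coupling, hence by `W₂`. -/

/-- The bias-variance decomposition of the mean squared deviation from a point. -/
theorem lintegral_sq_sub_eq_add {α : Type*} [MeasurableSpace α] {μ : Measure α}
    [IsProbabilityMeasure μ] {f : α → ℝ} (hf : MemLp f 2 μ) (a : ℝ) :
    ∫⁻ x, ENNReal.ofReal ((f x - a) ^ 2) ∂μ =
      ∫⁻ x, ENNReal.ofReal ((f x - ∫ t, f t ∂μ) ^ 2) ∂μ +
        ENNReal.ofReal (((∫ t, f t ∂μ) - a) ^ 2) := by
  have hf1 : Integrable f μ := hf.integrable one_le_two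
  have hsq (c : ℝ) : Integrable (fun x => (f x - c) ^ 2) μ :=
    (hf.sub (memLp_const c)).integrable_sq
  have hnn (c : ℝ) : 0 ≤ᵐ[μ] fun x => (f x - c) ^ 2 := Filter.Eventually.of_forall fun x => sq_nonneg _
  set m := ∫ t, f t ∂μ with hm
  rw [← ofReal_integral_eq_lintegral_ofReal (hsq a) (hnn a),
    ← ofReal_integral_eq_lintegral_ofReal (hsq m) (hnn m),
    ← ENNReal.ofReal_add (integral_nonneg fun x => sq_nonneg _) (sq_nonneg _)]
  congr 1
  have key : ∀ x, (f x - a) ^ 2 = (f x - m) ^ 2 + (2 * (m - a) * (f x - m) + (m - a) ^ 2) := by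
    intro x; ring
  have hlin : Integrable (fun x => f x - m) μ := hf1.sub (integrable_const m)
  have h0 : ∫ x, (f x - m) ∂μ = 0 := by
    rw [integral_sub hf1 (integrable_const m)]; simp [hm]
  simp_rw [key]
  have hlin' : Integrable (fun x => 2 * (m - a) * (f x - m)) μ := hlin.const_mul _
  have hadd : Integrable (fun x => 2 * (m - a) * (f x - m) + (m - a) ^ 2) μ :=
    hlin'.add (integrable_const _)
  rw [integral_add (hsq m) hadd, integral_add hlin' (integrable_const _), integral_const_mul, h0]
  simp

theorem memLp_two_of_lintegral_sq_lt_top {α : Type*} [MeasurableSpace α] {μ : Measure α}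
    {f : α → ℝ} (hf : AEStronglyMeasurable f μ)
    (h : ∫⁻ x, ENNReal.ofReal (f x ^ 2) ∂μ < ∞) : MemLp f 2 μ := by
  refine (memLp_two_iff_integrable_sq hf).2 ⟨hf.pow 2, ?_⟩
  rw [hasFiniteIntegral_iff_ofReal (Filter.Eventually.of_forall fun x => sq_nonneg _)]
  exact h

/-- Jensen's inequality for the square, in a form that needs no integrability. -/
theorem ofReal_sub_integral_sq_le {α : Type*} [MeasurableSpace α] {μ : Measure α}
    [IsProbabilityMeasure μ] {f : α → ℝ} (hf : AEStronglyMeasurable f μ) (c : ℝ) :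
    ENNReal.ofReal ((c - ∫ x, f x ∂μ) ^ 2) ≤ ∫⁻ x, ENNReal.ofReal ((f x - c) ^ 2) ∂μ := by
  -- An infinite right side covers every non-integrable `f`, whose integral is the default 0; a
  -- finite one puts `f` in L².
  rcases eq_top_or_lt_top (∫⁻ x, ENNReal.ofReal ((f x - c) ^ 2) ∂μ) with h | h
  · rw [h]; exact le_top
  · have h1 : MemLp (fun x => f x - c) 2 μ :=
      memLp_two_of_lintegral_sq_lt_top (hf.sub aestronglyMeasurable_const) h
    have h2 : MemLp f 2 μ := by
      refine (h1.add (memLp_const (μ := μ) (p := 2) c)).congr_norm hf ?_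
      exact Filter.Eventually.of_forall fun x => by simp
    rw [lintegral_sq_sub_eq_add h2 c, sub_sq_comm]
    exact le_add_self

namespace BayesLearning

/-- The squared difference of the means is at most the squared `2`-Wasserstein distance. -/
theorem ofReal_integral_sub_integral_sq_le_wasserstein2_sq {P Q : Measure ℝ}
    [IsProbabilityMeasure P] (hP : MemLp id 2 P) (hQ : MemLp id 2 Q) :
    ENNReal.ofReal (((∫ y, y ∂P) - ∫ y, y ∂Q) ^ 2) ≤ wasserstein2 P Q ^ 2 := by
  have hsq : wasserstein2 P Q ^ 2 = ⨅ (π : Measure (ℝ × ℝ)) (_ : π.fst = P ∧ π.snd = Q),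
      ∫⁻ p, ENNReal.ofReal (|p.1 - p.2| ^ 2) ∂π := by
    rw [wasserstein2, ← ENNReal.rpow_natCast, ← ENNReal.rpow_mul]
    norm_num
  rw [hsq]
  refine le_iInf₂ fun π hπ => ?_
  obtain ⟨rfl, rfl⟩ := hπ
  -- A coupling has the total mass of its first marginal.
  have : IsProbabilityMeasure π := ⟨by rw [← Measure.fst_univ]; exact measure_univ⟩
  have h1 : MemLp (fun p : ℝ × ℝ => p.1) 2 π := hP.comp_measurePreserving ⟨measurable_fst, rfl⟩
  have h2 : MemLp (fun p : ℝ × ℝ => p.2) 2 π := hQ.comp_measurePreserving ⟨measurable_snd, rfl⟩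
  have e1 : ∫ y, y ∂π.fst = ∫ p, p.1 ∂π :=
    integral_map measurable_fst.aemeasurable measurable_id.aestronglyMeasurable
  have e2 : ∫ y, y ∂π.snd = ∫ p, p.2 ∂π :=
    integral_map measurable_snd.aemeasurable measurable_id.aestronglyMeasurable
  rw [e1, e2, ← integral_sub (h1.integrable one_le_two) (h2.integrable one_le_two)]
  simpa using ofReal_sub_integral_sq_le (h1.sub h2).aestronglyMeasurable 0

section

variable {𝓦 𝓧 𝓨 : Type*} [MeasurableSpace 𝓦] [MeasurableSpace 𝓧] [MeasurableSpace 𝓨] {n : ℕ}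

theorem Sample.measurable_W : Measurable (Sample.W : Sample 𝓦 𝓧 𝓨 n → 𝓦) := measurable_fst

theorem Sample.measurable_data : Measurable (Sample.data : Sample 𝓦 𝓧 𝓨 n → _) :=
  measurable_fst.comp measurable_snd

theorem Sample.measurable_X : Measurable (Sample.X : Sample 𝓦 𝓧 𝓨 n → 𝓧) :=
  measurable_fst.comp (measurable_snd.comp measurable_snd)

theorem Sample.measurable_Y : Measurable (Sample.Y : Sample 𝓦 𝓧 𝓨 n → 𝓨) :=
  measurable_snd.comp (measurable_snd.comp measurable_snd)

/-- Disintegration of the joint law: `Y` has conditional law `K (X, W)` given `(W, Zⁿ, X)`. -/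
theorem lintegral_jointLaw (prior : Measure 𝓦) [IsProbabilityMeasure prior] (PX : Kernel 𝓦 𝓧)
    [IsMarkovKernel PX] (K : Kernel (𝓧 × 𝓦) 𝓨) [IsMarkovKernel K]
    {g : Sample 𝓦 𝓧 𝓨 n → ℝ≥0∞} (hg : Measurable g) :
    ∫⁻ s, g s ∂(jointLaw prior PX K n) =
      ∫⁻ s, ∫⁻ y, g (s.W, s.data, s.X, y) ∂(K (s.X, s.W)) ∂(jointLaw prior PX K n) := by
  have hg' : Measurable fun s : Sample 𝓦 𝓧 𝓨 n =>
      ∫⁻ y, g (s.W, s.data, s.X, y) ∂(K (s.X, s.W)) := by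
    have hXW : Measurable fun s : Sample 𝓦 𝓧 𝓨 n => (s.X, s.W) :=
      Sample.measurable_X.prodMk Sample.measurable_W
    refine Measurable.lintegral_kernel_prod_right' (κ := K.comap _ hXW)
      (f := fun p : Sample 𝓦 𝓧 𝓨 n × 𝓨 => g (p.1.W, p.1.data, p.1.X, p.2)) ?_
    exact hg.comp ((Sample.measurable_W.comp measurable_fst).prodMk
      ((Sample.measurable_data.comp measurable_fst).prodMk
        ((Sample.measurable_X.comp measurable_fst).prodMk measurable_snd)))
  rw [jointLaw, Measure.lintegral_compProd hg, Measure.lintegral_compProd hg']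
  refine lintegral_congr fun w => ?_
  have hw : Measurable fun b : (Fin n → 𝓧 × 𝓨) × (𝓧 × 𝓨) => g (w, b) := hg.comp measurable_prodMk_left
  have hw' : Measurable fun b : (Fin n → 𝓧 × 𝓨) × (𝓧 × 𝓨) =>
      ∫⁻ y, g (w, b.1, b.2.1, y) ∂(K (b.2.1, w)) := hg'.comp (measurable_prodMk_left (x := w))
  change _ = ∫⁻ b : (Fin n → 𝓧 × 𝓨) × (𝓧 × 𝓨), ∫⁻ y, g (w, b.1, b.2.1, y) ∂(K (b.2.1, w)) ∂_
  rw [Kernel.prod_apply, lintegral_prod _ hw.aemeasurable, lintegral_prod _ hw'.aemeasurable]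
  refine lintegral_congr fun z => ?_
  have hz : Measurable fun c : 𝓧 × 𝓨 => g (w, z, c) := hw.comp measurable_prodMk_left
  have hz' : Measurable fun c : 𝓧 × 𝓨 => ∫⁻ y, g (w, z, c.1, y) ∂(K (c.1, w)) :=
    hw'.comp measurable_prodMk_left
  rw [generativeKernel, Kernel.lintegral_compProd _ _ _ hz, Kernel.lintegral_compProd _ _ _ hz']
  refine lintegral_congr fun x => ?_
  -- On the right the integrand is constant in the fresh `y`, and `K (x, w)` has mass one.
  simp [Kernel.swapLeft_apply]

end

theorem bayesRisk_quadraticLoss_le_lintegral_sq {Ω 𝓥 : Type*} [MeasurableSpace Ω]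
    [MeasurableSpace 𝓥] (μ : Measure Ω) (Y : Ω → ℝ) (V : Ω → 𝓥) :
    bayesRisk quadraticLoss μ Y V ≤ ∫⁻ ω, ENNReal.ofReal (Y ω ^ 2) ∂μ :=
  (iInf₂_le (fun _ => (0 : ℝ)) measurable_const).trans (by simp [quadraticLoss])

section

variable {𝓦 𝓧 : Type*} [MeasurableSpace 𝓦] [StandardBorelSpace 𝓦] [Nonempty 𝓦]
  [MeasurableSpace 𝓧]

instance (prior : Measure 𝓦) [IsProbabilityMeasure prior] (PX : Kernel 𝓦 𝓧) [IsMarkovKernel PX]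
    (K : Kernel (𝓧 × 𝓦) ℝ) [IsMarkovKernel K] (n : ℕ) :
    IsMarkovKernel (posteriorKernel prior PX K n) := by
  unfold posteriorKernel; infer_instance

/-- The excess risk of predicting with the posterior mean of `E[Y|x,w]` is at most the expected
squared Wasserstein distance between the predictive kernels at `W'` and at `W`. -/
theorem bayesRisk_data_le_bayesRisk_param_add_lintegral_wasserstein2_sq
    (prior : Measure 𝓦) [IsProbabilityMeasure prior] (PX : Kernel 𝓦 𝓧) [IsMarkovKernel PX]
    (K : Kernel (𝓧 × 𝓦) ℝ) [IsMarkovKernel K] (n : ℕ)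
    (hK : ∀ (x : 𝓧) (w : 𝓦), ∫⁻ y, ENNReal.ofReal (y ^ 2) ∂(K (x, w)) < ∞) :
    bayesRisk quadraticLoss (jointLaw prior PX K n) Sample.Y (fun s => (s.X, s.data)) ≤
      bayesRisk quadraticLoss (jointLaw prior PX K n) Sample.Y (fun s => (s.X, s.W)) +
        ∫⁻ q, wasserstein2 (K (q.1.X, q.2)) (K (q.1.X, q.1.W)) ^ 2
          ∂(jointLawWithPosteriorSample prior PX K n) := by
  have hL (x : 𝓧) (w : 𝓦) : MemLp id 2 (K (x, w)) :=
    memLp_two_of_lintegral_sq_lt_top measurable_id.aestronglyMeasurable (hK x w)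
  set J := jointLaw prior PX K n with hJ
  set m : 𝓧 × 𝓦 → ℝ := fun p => ∫ y, y ∂(K p) with hm
  have hmm : Measurable m :=
    (StronglyMeasurable.integral_kernel_prod_right' (κ := K)
      (f := fun p : (𝓧 × 𝓦) × ℝ => p.2) measurable_snd.stronglyMeasurable).measurable
  -- Where `m` is not integrable under the posterior this is 0, which is harmless: the Jensen bound
  -- below is then infinite.
  set ψ : 𝓧 × (Fin n → 𝓧 × ℝ) → ℝ := fun v => ∫ w, m (v.1, w) ∂(posteriorKernel prior PX K n v)
    with hψ
  have hψm : Measurable ψ :=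
    (StronglyMeasurable.integral_kernel_prod_right' (κ := posteriorKernel prior PX K n)
      (f := fun p : (𝓧 × (Fin n → 𝓧 × ℝ)) × 𝓦 => m (p.1.1, p.2))
      (hmm.comp (by fun_prop)).stronglyMeasurable).measurable
  have hX : Measurable fun s : Sample 𝓦 𝓧 ℝ n => s.X := Sample.measurable_X
  have hW : Measurable fun s : Sample 𝓦 𝓧 ℝ n => s.W := Sample.measurable_W
  have hD : Measurable fun s : Sample 𝓦 𝓧 ℝ n => s.data := Sample.measurable_data
  have hY : Measurable fun s : Sample 𝓦 𝓧 ℝ n => s.Y := Sample.measurable_Y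
  have hdec (p : 𝓧 × 𝓦) (a : ℝ) : ∫⁻ y, quadraticLoss y a ∂(K p) =
      ∫⁻ y, quadraticLoss y (m p) ∂(K p) + ENNReal.ofReal ((m p - a) ^ 2) :=
    lintegral_sq_sub_eq_add (hL p.1 p.2) a
  -- `hφY` says that the rule does not look at `Y`. The first summand is the same for every such
  -- rule, so data-based and parameter-based risks can be compared.
  have hrisk {φ : Sample 𝓦 𝓧 ℝ n → ℝ} (hφ : Measurable φ)
      (hφY : ∀ s y, φ (s.W, s.data, s.X, y) = φ s) :
      ∫⁻ s, quadraticLoss s.Y (φ s) ∂J =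
        ∫⁻ s, ∫⁻ y, quadraticLoss y (m (s.X, s.W)) ∂(K (s.X, s.W)) ∂J +
          ∫⁻ s, ENNReal.ofReal ((m (s.X, s.W) - φ s) ^ 2) ∂J := by
    rw [hJ, lintegral_jointLaw prior PX K (g := fun s => quadraticLoss s.Y (φ s))
      (by unfold quadraticLoss; fun_prop), ← lintegral_add_right _ (by fun_prop)]
    refine lintegral_congr fun s => ?_
    simp only [hφY, ← hdec]
    rfl
  refine (iInf₂_le ψ hψm).trans ?_
  rw [hrisk (φ := fun s => ψ (s.X, s.data)) (by fun_prop) fun _ _ => rfl]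
  refine add_le_add (le_iInf₂ fun φ hφ => ?_) ?_
  · rw [hrisk (φ := fun s => φ (s.X, s.W)) (by fun_prop) fun _ _ => rfl]
    exact le_self_add
  -- Of the posterior, only its being a Markov kernel enters here.
  · calc ∫⁻ s, ENNReal.ofReal ((m (s.X, s.W) - ψ (s.X, s.data)) ^ 2) ∂J
      _ ≤ ∫⁻ s, ∫⁻ w, ENNReal.ofReal ((m (s.X, w) - m (s.X, s.W)) ^ 2)
            ∂(posteriorKernel prior PX K n (s.X, s.data)) ∂J :=
          lintegral_mono fun s => ofReal_sub_integral_sq_le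
            (hmm.comp measurable_prodMk_left).aestronglyMeasurable _
      _ = ∫⁻ q, ENNReal.ofReal ((m (q.1.X, q.2) - m (q.1.X, q.1.W)) ^ 2)
            ∂(jointLawWithPosteriorSample prior PX K n) := by
          have := Kernel.IsSFiniteKernel.comap (posteriorKernel prior PX K n) (hX.prodMk hD)
          rw [jointLawWithPosteriorSample, Measure.lintegral_compProd (by fun_prop)]
          rfl
      _ ≤ _ := lintegral_mono fun q =>
          ofReal_integral_sub_integral_sq_le_wasserstein2_sq (hL _ _) (hL _ _)

end

end BayesLearning

/-- Since `r * r ≤ a * b`, the case `0 * ∞ = 0` needs no separate treatment: there `r = 0`. -/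
theorem ENNReal.le_four_mul_sqrt_mul {r a b : ℝ≥0∞} (ha : r ≤ a) (hb : r ≤ b) :
    r ≤ 4 * (a * b) ^ (1 / 2 : ℝ) := by
  have h : r ≤ (a * b) ^ (1 / 2 : ℝ) := by
    calc r = (r * r) ^ (1 / 2 : ℝ) := by
          rw [← sq, ← ENNReal.rpow_natCast, ← ENNReal.rpow_mul]; norm_num
      _ ≤ _ := ENNReal.rpow_le_rpow (mul_le_mul' ha hb) (by norm_num)
  exact h.trans (le_mul_of_one_le_left' (by norm_num))

theorem mainTheorem11 {𝓦 𝓧 : Type*}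
    [MeasurableSpace 𝓦] [StandardBorelSpace 𝓦] [Nonempty 𝓦]
    [MeasurableSpace 𝓧] [StandardBorelSpace 𝓧]
    (prior : Measure 𝓦) [IsProbabilityMeasure prior]
    (PX : Kernel 𝓦 𝓧) [IsMarkovKernel PX]
    (K : Kernel (𝓧 × 𝓦) ℝ) [IsMarkovKernel K] (n : ℕ)
    (hK : ∀ (x : 𝓧) (w : 𝓦), ∫⁻ y, ENNReal.ofReal (y ^ 2) ∂(K (x, w)) < ∞) :
    BayesLearning.MER BayesLearning.quadraticLoss prior PX K n ≤
      ((4 * ((∫⁻ s, ENNReal.ofReal (s.Y ^ 2) ∂(BayesLearning.jointLaw prior PX K n)) *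
          ∫⁻ q, BayesLearning.wasserstein2 (K (q.1.X, q.2)) (K (q.1.X, q.1.W)) ^ 2
            ∂(BayesLearning.jointLawWithPosteriorSample prior PX K n)) ^ (1 / 2 : ℝ) : ℝ≥0∞) :
        EReal) := by

  have hle := BayesLearning.bayesRisk_data_le_bayesRisk_param_add_lintegral_wasserstein2_sq
    prior PX K n hK
  have hA := BayesLearning.bayesRisk_quadraticLoss_le_lintegral_sq
    (BayesLearning.jointLaw prior PX K n) BayesLearning.Sample.Y (fun s => (s.X, s.data))
  unfold BayesLearning.MER
  rcases eq_or_ne (BayesLearning.bayesRisk BayesLearning.quadraticLoss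
    (BayesLearning.jointLaw prior PX K n) BayesLearning.Sample.Y (fun s => (s.X, s.W))) ∞ with h | h
  -- In `EReal`, subtracting `⊤` always gives `⊥`, even from `⊤`.
  · rw [h]; simp
  · refine EReal.sub_le_of_le_add' ?_
    rw [← EReal.coe_ennreal_add, EReal.coe_ennreal_le_coe_ennreal_iff, ← tsub_le_iff_left]
    -- Here `r` is the truncated difference of the two risks.
    exact ENNReal.le_four_mul_sqrt_mul (tsub_le_self.trans hA) (tsub_le_iff_left.2 hle)
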